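/- For real $\mu>-1$ and $t>0$ let $I_\mu(t)=\sum_{k=0}^\infty \frac{(t/2)^{2k+\mu}}{k!\,\Gamma(\mu+k+1)}$ be the modified Bessel function of the first kind. For $\nu>0$, $a>0$, $b\ge 0$ let $$Q_\nu(a,b)=\int_b^\infty \frac{t^\nu}{a^{\nu-1}}\exp\left(-\frac{t^2+a^2}{2}\right) I_{\nu-1}(at)\,dt$$ be the generalized Marcum Q function, and let $Q_\nu(0,b)=\lim_{a\downarrow 0}Q_\nu(a,b)$. A nonnegative function $f$ on $[0,\infty)$ is called log-concave if $f(px+qy)\ge f(x)^p f(y)^q$ for all $x,y\ge 0$ and all $p,q\ge 0$ with $p+q=1$. (i) If $\nu\ge 1/2$ and $0\le a\le 1$, then $b\mapsto 1-Q_\nu(a,b)$ is log-concave on $[0,\infty)$. (ii) The equation $$\frac{I_\nu(\sqrt{5-2\nu})}{I_{\nu-1}(\sqrt{5-2\nu})}=\frac{3-2\nu}{\sqrt{5-2\nu}}$$ has exactly one solution $\nu_0$ in the interval $1/2<\nu<3/2$; it satisfies $\nu_0\approx 0.78449776$ (rounded to eight decimals, that is $|\nu_0-0.78449776|\le \tfrac12\cdot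 10^{-8}$); and if $\nu\ge\nu_0$ and $a\ge 0$, then $b\mapsto 1-Q_\nu(a,b)$ is log-concave on $[0,\infty)$. -/

import Mathlib

open Set Filter Topology MeasureTheory

noncomputable section

/-- The modified Bessel function of the first kind of real order `μ` (used for `μ > -1` and
positive argument `t`), given by its series. -/
def besselI (μ t : ℝ) : ℝ :=
  ∑' k : ℕ, (t / 2) ^ (2 * (k : ℝ) + μ) / ((k.factorial : ℝ) * Real.Gamma (μ + k + 1))

/-- The integrand of the generalized Marcum Q function, for `a > 0`. -/
def marcumIntegrand (ν a t : ℝ) : ℝ :=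
  t ^ ν / a ^ (ν - 1) * Real.exp (-(t ^ 2 + a ^ 2) / 2) * besselI (ν - 1) (a * t)

/-- The integral that defines the generalized Marcum Q function, for `a > 0`. -/
def marcumIntegral (ν a b : ℝ) : ℝ :=
  ∫ t in Ioi b, marcumIntegrand ν a t

/-- The generalized Marcum Q function `Q_ν(a, b)` for `ν > 0` and `a, b ≥ 0`. For `a = 0` it is
the limit of `Q_ν(a', b)` as `a'` decreases to `0`. -/
def marcumQ (ν a b : ℝ) : ℝ :=
  if a = 0 then limUnder (𝓝[>] (0 : ℝ)) (fun a' => marcumIntegral ν a' b)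
  else marcumIntegral ν a b

/-- A real function `f` is log-concave on `s`: `s` is convex, `f` is nonnegative on `s`, and
`f (p x + q y) ≥ f x ^ p * f y ^ q` for all `x, y ∈ s` and all weights `p, q` with sum one. -/
def LogConcaveOn (s : Set ℝ) (f : ℝ → ℝ) : Prop :=
  Convex ℝ s ∧ (∀ x ∈ s, 0 ≤ f x) ∧
    ∀ x ∈ s, ∀ y ∈ s, ∀ p q : ℝ, 0 ≤ p → 0 ≤ q → p + q = 1 →
      f x ^ p * f y ^ q ≤ f (p * x + q * y)

/-- `ν` solves `I_ν(√(5 - 2ν)) / I_{ν-1}(√(5 - 2ν)) = (3 - 2ν) / √(5 - 2ν)` and lies in the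
interval `(1/2, 3/2)`. -/
def IsCriticalOrder (ν : ℝ) : Prop :=
  ν ∈ Ioo (1 / 2 : ℝ) (3 / 2) ∧
    besselI ν (Real.sqrt (5 - 2 * ν)) / besselI (ν - 1) (Real.sqrt (5 - 2 * ν)) =
      (3 - 2 * ν) / Real.sqrt (5 - 2 * ν)

end

/-! For `a > 0` the integrand is the noncentral chi density, a constant times `t ^ (2ν-1) * exp
(-t²/2) * J(a²t²/4)` with `J = besselSeries ν`. It has total mass one, so `1 - Q` is its
distribution function, also at `a = 0` by continuity in `a`. A log-concave density has a log-concave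
distribution function (`logConcaveOn_integral`), so it suffices to bound the second derivative of
the log-density.

Put `m = 2ν - 1`, `z = a²t²/4` and `R = z J'(z) / J(z)`. Then `t²` times that second derivative is
`4z - 2mR - 4R² - m - t²`. If `a ≤ 1`, then `4z ≤ t²` and the sign is clear. For arbitrary `a` it is
enough that `B = 4R² + 2mR + m - 4z` is nonnegative for all `z > 0`. The Riccati equation for `R`
shows that `z ^ (ν - 3/2) * J² * B` has a derivative with the sign of `m (2R - (3 - 2ν))`. Since `R`
increases, the only possible interior minimum for `ν < 3/2` is where `2R = 3 - 2ν`; there `B = 5 -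
2ν - 4z`. So the condition becomes `2R ≥ 3 - 2ν` at `z = (5 - 2ν)/4`, and equality is exactly the
critical equation. For `ν ≥ 3/2` the product is monotone.

The sign of `2R - (3 - 2ν)` at that point is the sign of an explicit series `critFun ν`. It is
strictly increasing on `[1/2, 3/2]`, since its summand `ν²` outweighs any decrease of the other
terms. This gives uniqueness and the range `ν ≥ ν₀`; rational bounds at two points locate the root.
-/

/-! ### The Bessel series: convergence, recurrence, derivative -/

/-- The entire function `∑ z ^ k / (k! Γ(ν + k))`, which is the modified Bessel function
`I_{ν-1}` up to a power factor and the substitution `z = x² / 4`. -/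
noncomputable def besselSeries (ν z : ℝ) : ℝ :=
  ∑' k : ℕ, z ^ k / ((k.factorial : ℝ) * Real.Gamma (ν + k))

/-- From `k = 1` on the factor `ν + k` in `Γ(ν + k + 1) = (ν + k) Γ(ν + k)` is at least one, so only
the first value has to be compared separately. The bound lets the exponential series dominate
`besselSeries`. -/
theorem exists_pos_le_Gamma_add_nat {ν : ℝ} (hν : 0 < ν) :
    ∃ c : ℝ, 0 < c ∧ ∀ k : ℕ, c ≤ Real.Gamma (ν + k) := by
  have h1 : ∀ k : ℕ, Real.Gamma (ν + 1) ≤ Real.Gamma (ν + (k + 1 : ℕ)) := by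
    intro k
    induction k with
    | zero => simp
    | succ k ih =>
      have hpos : 0 < ν + ((k + 1 : ℕ) : ℝ) := by positivity
      have : ν + ((k + 1 + 1 : ℕ) : ℝ) = ν + ((k + 1 : ℕ) : ℝ) + 1 := by push_cast; ring
      rw [this, Real.Gamma_add_one hpos.ne']
      have hG := Real.Gamma_pos_of_pos hpos
      have h1 : (1 : ℝ) ≤ ν + ((k + 1 : ℕ) : ℝ) := by
        push_cast; have : (0 : ℝ) ≤ k := by positivity
        linarith
      nlinarith
  refine ⟨min (Real.Gamma ν) (Real.Gamma (ν + 1)),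
    lt_min (Real.Gamma_pos_of_pos hν) (Real.Gamma_pos_of_pos (by linarith)), fun k => ?_⟩
  cases k with
  | zero => simp
  | succ k => exact (min_le_right _ _).trans (h1 k)

theorem summable_besselSeries {ν : ℝ} (hν : 0 < ν) (z : ℝ) :
    Summable fun k : ℕ => z ^ k / ((k.factorial : ℝ) * Real.Gamma (ν + k)) := by
  obtain ⟨c, hc, h⟩ := exists_pos_le_Gamma_add_nat hν
  refine Summable.of_norm_bounded ((Real.summable_pow_div_factorial |z|).mul_right c⁻¹)
    fun k => ?_
  have hG : 0 < Real.Gamma (ν + k) := Real.Gamma_pos_of_pos (by positivity)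
  rw [norm_div, norm_pow, Real.norm_eq_abs, Real.norm_of_nonneg (by positivity),
    ← div_div, div_eq_mul_inv _ (Real.Gamma _)]
  gcongr
  exact h k

theorem besselSeries_pos {ν : ℝ} (hν : 0 < ν) {z : ℝ} (hz : 0 ≤ z) : 0 < besselSeries ν z := by
  refine (summable_besselSeries hν z).tsum_pos (fun k => ?_) 0 ?_
  · have hG : 0 < Real.Gamma (ν + k) := Real.Gamma_pos_of_pos (by positivity)
    positivity
  · have hG : 0 < Real.Gamma ν := Real.Gamma_pos_of_pos hν
    simpa using hG

/-- Write `1 / Γ(ν + k) = (ν + k) / Γ(ν + k + 1)` and split the factor `ν + k`; the part with `k`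
cancels against `k!` and shifts the index. -/
theorem besselSeries_recurrence {ν : ℝ} (hν : 0 < ν) (z : ℝ) :
    besselSeries ν z = ν * besselSeries (ν + 1) z + z * besselSeries (ν + 2) z := by
  unfold besselSeries
  rw [(summable_besselSeries hν z).tsum_eq_zero_add,
    (summable_besselSeries (by linarith : 0 < ν + 1) z).tsum_eq_zero_add, mul_add,
    ← tsum_mul_left, ← tsum_mul_left, add_assoc, ← Summable.tsum_add]
  · congr 1
    · have := (Real.Gamma_pos_of_pos hν).ne'
      simp [Real.Gamma_add_one hν.ne']
      field_simp
    · refine tsum_congr fun k => ?_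
      have hpos : 0 < ν + k + 1 := by positivity
      have hG := (Real.Gamma_pos_of_pos hpos).ne'
      have e1 : ν + ((k + 1 : ℕ) : ℝ) = ν + k + 1 := by push_cast; ring
      have e2 : ν + 1 + ((k + 1 : ℕ) : ℝ) = ν + k + 1 + 1 := by push_cast; ring
      have e3 : ν + 2 + (k : ℝ) = ν + k + 1 + 1 := by ring
      rw [e1, e2, e3, Real.Gamma_add_one hpos.ne', Nat.factorial_succ]
      push_cast
      field_simp
      ring
  · exact ((summable_nat_add_iff 1).2
      (summable_besselSeries (by linarith : 0 < ν + 1) z)).mul_left _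
  · exact (summable_besselSeries (by linarith : 0 < ν + 2) z).mul_left _

theorem hasDerivAt_besselSeries {ν : ℝ} (hν : 0 < ν) (z : ℝ) :
    HasDerivAt (besselSeries ν) (besselSeries (ν + 1) z) z := by
  obtain ⟨c, hc, h⟩ := exists_pos_le_Gamma_add_nat hν
  set r : ℝ := |z| + 1
  have hu : Summable fun k : ℕ => (k : ℝ) * r ^ (k - 1) / (k.factorial * c) := by
    rw [← summable_nat_add_iff 1]
    refine ((Real.summable_pow_div_factorial r).mul_right c⁻¹).congr fun k => ?_
    rw [Nat.factorial_succ]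
    push_cast
    field_simp
  have key := hasDerivAt_tsum_of_isPreconnected
    (g := fun (k : ℕ) (y : ℝ) => y ^ k / ((k.factorial : ℝ) * Real.Gamma (ν + k)))
    (g' := fun (k : ℕ) (y : ℝ) => (k : ℝ) * y ^ (k - 1) / (k.factorial * Real.Gamma (ν + k)))
    (t := Metric.ball 0 r) (y₀ := 0) (y := z) hu Metric.isOpen_ball
    (convex_ball 0 r).isPreconnected
    (fun k y _ => (hasDerivAt_pow k y).div_const _) (fun k y hy => ?_)
    (by simp [r]; positivity) (summable_besselSeries hν 0) (by simp [r])
  · have he : ∑' k : ℕ, (k : ℝ) * z ^ (k - 1) / (k.factorial * Real.Gamma (ν + k)) =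
        besselSeries (ν + 1) z := by
      rw [Summable.tsum_eq_zero_add]
      · simp only [Nat.cast_zero, zero_mul, zero_div, zero_add]
        refine tsum_congr fun k => ?_
        have e1 : ν + ((k + 1 : ℕ) : ℝ) = ν + 1 + k := by push_cast; ring
        rw [e1, Nat.factorial_succ]
        push_cast
        rw [mul_assoc, mul_div_mul_left _ _ (by positivity)]
      · rw [← summable_nat_add_iff 1]
        refine (summable_besselSeries (by linarith : 0 < ν + 1) z).congr fun k => ?_
        have e1 : ν + ((k + 1 : ℕ) : ℝ) = ν + 1 + k := by push_cast; ring
        rw [e1, Nat.factorial_succ]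
        push_cast
        rw [mul_assoc, mul_div_mul_left _ _ (by positivity)]
    rw [← he]
    exact key
  · have hG : 0 < Real.Gamma (ν + k) := Real.Gamma_pos_of_pos (by positivity)
    have hy' : |y| ≤ r := by simpa using (Metric.mem_ball.1 hy).le
    rw [norm_div, norm_mul, norm_pow, Real.norm_eq_abs y, Real.norm_of_nonneg (by positivity),
      Real.norm_of_nonneg (by positivity)]
    gcongr
    exact h k

theorem continuous_besselSeries {ν : ℝ} (hν : 0 < ν) : Continuous (besselSeries ν) :=
  continuous_iff_continuousAt.2 fun z => (hasDerivAt_besselSeries hν z).continuousAt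

theorem besselI_sub_one_eq {ν x : ℝ} (hx : 0 < x) :
    besselI (ν - 1) x = (x / 2) ^ (ν - 1) * besselSeries ν (x ^ 2 / 4) := by
  unfold besselI besselSeries
  rw [← tsum_mul_left]
  refine tsum_congr fun k => ?_
  have e : ν - 1 + k + 1 = ν + (k : ℝ) := by ring
  have e2 : x ^ 2 / 4 = (x / 2) ^ 2 := by ring
  rw [e, Real.rpow_add (by positivity), e2, ← pow_mul, ← Real.rpow_natCast (x / 2) (2 * k)]
  push_cast
  ring

/-! ### The logarithmic derivative and the barrier inequality -/

/-- The logarithmic derivative `z J'(z) / J(z)` of `J = besselSeries ν`. -/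
noncomputable def besselLogDeriv (ν z : ℝ) : ℝ :=
  z * besselSeries (ν + 1) z / besselSeries ν z

theorem besselLogDeriv_nonneg {ν z : ℝ} (hν : 0 < ν) (hz : 0 ≤ z) : 0 ≤ besselLogDeriv ν z :=
  div_nonneg (mul_nonneg hz (besselSeries_pos (by linarith) hz).le) (besselSeries_pos hν hz).le

theorem mul_besselSeries_add_two {ν : ℝ} (hν : 0 < ν) (z : ℝ) :
    z * besselSeries (ν + 1 + 1) z = besselSeries ν z - ν * besselSeries (ν + 1) z := by
  have h := besselSeries_recurrence hν z
  rw [show ν + 1 + 1 = ν + 2 by ring]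
  linarith

/-- This is the Riccati form of the second-order equation for `J`; the recurrence eliminates `J''`.
-/
theorem hasDerivAt_besselLogDeriv {ν z : ℝ} (hν : 0 < ν) (hz : 0 < z) :
    HasDerivAt (besselLogDeriv ν)
      ((z + (1 - ν) * besselLogDeriv ν z - besselLogDeriv ν z ^ 2) / z) z := by
  have h0 := hasDerivAt_besselSeries hν z
  have h1 := hasDerivAt_besselSeries (by linarith : 0 < ν + 1) z
  have hJ := (besselSeries_pos hν hz.le).ne'
  have hrec := mul_besselSeries_add_two hν z
  refine (((hasDerivAt_id z).mul h1).div h0 hJ).congr_deriv ?_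
  simp only [besselLogDeriv, id_eq, Pi.mul_apply]
  rw [hrec]
  field_simp
  ring

theorem continuousOn_besselLogDeriv {ν : ℝ} (hν : 0 < ν) :
    ContinuousOn (besselLogDeriv ν) (Ici 0) :=
  (continuous_id.mul (continuous_besselSeries (by linarith))).continuousOn.div
    (continuous_besselSeries hν).continuousOn fun _ hz => (besselSeries_pos hν hz).ne'

/-- Multiplied by `z ^ (ν - 1) * J²`, the expression becomes a function `K` with `K 0 = 0` and `K' =
z ^ (ν - 1) * J² > 0`. -/
theorem deriv_besselLogDeriv_numerator_pos {ν z : ℝ} (hν : 0 < ν) (hz : 0 < z) :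
    0 < z + (1 - ν) * besselLogDeriv ν z - besselLogDeriv ν z ^ 2 := by
  set K : ℝ → ℝ := fun z => z ^ ν * (besselSeries ν z ^ 2 +
    (1 - ν) * (besselSeries ν z * besselSeries (ν + 1) z) - z * besselSeries (ν + 1) z ^ 2) with hK
  have hc0 := continuous_besselSeries hν
  have hc1 := continuous_besselSeries (by linarith : 0 < ν + 1)
  have hcont : ContinuousOn K (Ici 0) :=
    ((Real.continuous_rpow_const hν.le).mul (by fun_prop)).continuousOn
  have hderiv : ∀ y > 0, HasDerivAt K (y ^ (ν - 1) * besselSeries ν y ^ 2) y := by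
    intro y hy
    have h0 := hasDerivAt_besselSeries hν y
    have h1 := hasDerivAt_besselSeries (by linarith : 0 < ν + 1) y
    have hrec := mul_besselSeries_add_two hν y
    have hp := Real.hasDerivAt_rpow_const (x := y) (p := ν) (Or.inl hy.ne')
    refine (hp.mul (((h0.pow 2).add ((h0.mul h1).const_mul (1 - ν))).sub
      ((hasDerivAt_id y).mul (h1.pow 2)))).congr_deriv ?_
    have hpow : y ^ ν = y ^ (ν - 1) * y := by
      rw [← Real.rpow_add_one hy.ne']; congr 1; ring
    simp only [Pi.mul_apply, Pi.pow_apply, Pi.add_apply, Pi.sub_apply, id_eq]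
    rw [hpow]
    push_cast
    linear_combination (y ^ (ν - 1) * ((1 - ν) * besselSeries ν y
      - 2 * y * besselSeries (ν + 1) y)) * hrec
  have hmono : StrictMonoOn K (Ici 0) := by
    refine strictMonoOn_of_deriv_pos (convex_Ici 0) hcont fun y hy => ?_
    rw [interior_Ici] at hy
    rw [(hderiv y hy).deriv]
    have := besselSeries_pos hν (le_of_lt hy)
    have := Real.rpow_pos_of_pos hy (ν - 1)
    positivity
  have h0 : K 0 = 0 := by simp [hK, Real.zero_rpow hν.ne']
  have hpos : 0 < K z := h0 ▸ hmono self_mem_Ici hz.le hz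
  have hJ := besselSeries_pos hν hz.le
  have hz' := Real.rpow_pos_of_pos hz ν
  have : z + (1 - ν) * besselLogDeriv ν z - besselLogDeriv ν z ^ 2 =
      K z * z / (z ^ ν * besselSeries ν z ^ 2) := by
    simp only [hK, besselLogDeriv]
    field_simp
  rw [this]
  positivity

theorem strictMonoOn_besselLogDeriv {ν : ℝ} (hν : 0 < ν) :
    StrictMonoOn (besselLogDeriv ν) (Ici 0) := by
  refine strictMonoOn_of_deriv_pos (convex_Ici 0) (continuousOn_besselLogDeriv hν) fun y hy => ?_
  rw [interior_Ici] at hy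
  rw [(hasDerivAt_besselLogDeriv hν hy).deriv]
  exact div_pos (deriv_besselLogDeriv_numerator_pos hν hy) hy

/-- The derivative of the integrating factor times `m - y`, where `m = 2 ν - 1` and
`y = 4 z - 2 m R - 4 R ^ 2` with `R = besselLogDeriv ν z`. -/
theorem hasDerivAt_barrier {ν z : ℝ} (hν : 0 < ν) (hz : 0 < z) :
    HasDerivAt (fun z => z ^ (ν - 3 / 2) * besselSeries ν z ^ 2 * (4 * besselLogDeriv ν z ^ 2 +
        2 * (2 * ν - 1) * besselLogDeriv ν z + (2 * ν - 1) - 4 * z))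
      ((2 * ν - 1) / 2 * z ^ (ν - 3 / 2) / z * besselSeries ν z ^ 2 *
        (2 * besselLogDeriv ν z - (3 - 2 * ν))) z := by
  have h0 := hasDerivAt_besselSeries hν z
  have hR := hasDerivAt_besselLogDeriv hν hz
  have hJ := (besselSeries_pos hν hz.le).ne'
  have hp := Real.hasDerivAt_rpow_const (x := z) (p := ν - 3 / 2) (Or.inl hz.ne')
  have hJ1 : besselSeries (ν + 1) z = besselLogDeriv ν z * besselSeries ν z / z := by
    simp only [besselLogDeriv]; field_simp
  refine ((hp.mul (h0.pow 2)).mul ((((hR.pow 2).const_mul 4).add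
    (hR.const_mul (2 * (2 * ν - 1)))).add_const (2 * ν - 1) |>.sub
      ((hasDerivAt_id z).const_mul 4))).congr_deriv ?_
  simp only [Pi.mul_apply, Pi.pow_apply, Pi.add_apply, Pi.sub_apply, id_eq]
  rw [hJ1, Real.rpow_sub_one hz.ne']
  push_cast
  field_simp
  ring

/-- The product `Φ` falls while `2R < 3 - 2ν` and rises afterwards, so its sign need only be checked
at the turning point or, for `ν ≥ 3/2`, near zero. -/
theorem besselLogDeriv_barrier_nonneg {ν : ℝ} (hν : 1 / 2 ≤ ν)
    (hcrit : 3 / 2 ≤ ν ∨ 3 - 2 * ν ≤ 2 * besselLogDeriv ν ((5 - 2 * ν) / 4))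
    {z : ℝ} (hz : 0 < z) :
    0 ≤ 4 * besselLogDeriv ν z ^ 2 + 2 * (2 * ν - 1) * besselLogDeriv ν z + (2 * ν - 1)
      - 4 * z := by
  have hν0 : 0 < ν := by linarith
  set Φ : ℝ → ℝ := fun z => z ^ (ν - 3 / 2) * besselSeries ν z ^ 2 *
    (4 * besselLogDeriv ν z ^ 2 + 2 * (2 * ν - 1) * besselLogDeriv ν z + (2 * ν - 1) - 4 * z)
    with hΦ
  have hsign : ∀ y > 0, (0 ≤ Φ y ↔ 0 ≤ 4 * besselLogDeriv ν y ^ 2 +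
      2 * (2 * ν - 1) * besselLogDeriv ν y + (2 * ν - 1) - 4 * y) := fun y hy =>
    mul_nonneg_iff_of_pos_left (mul_pos (Real.rpow_pos_of_pos hy _)
      (pow_pos (besselSeries_pos hν0 hy.le) 2))
  have hcont : ContinuousOn Φ (Ioi 0) := fun y hy =>
    (hasDerivAt_barrier hν0 hy).continuousAt.continuousWithinAt
  have hfac : ∀ y > 0, 0 ≤ (2 * ν - 1) / 2 * y ^ (ν - 3 / 2) / y * besselSeries ν y ^ 2 :=
    fun y hy => by
      have : 0 ≤ 2 * ν - 1 := by linarith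
      have := Real.rpow_pos_of_pos hy (ν - 3 / 2)
      positivity
  have hmono : ∀ z₀ > 0, 3 - 2 * ν ≤ 2 * besselLogDeriv ν z₀ → MonotoneOn Φ (Ici z₀) := by
    intro z₀ hz₀ h
    have hsub : Ici z₀ ⊆ Ioi 0 := fun y hy => lt_of_lt_of_le hz₀ hy
    refine monotoneOn_of_deriv_nonneg (convex_Ici z₀) (hcont.mono hsub) (fun y hy => ?_)
      fun y hy => ?_
    · exact (hasDerivAt_barrier hν0
        (hsub (interior_subset hy))).differentiableAt.differentiableWithinAt
    · have hy' := interior_subset hy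
      have hy0 := hsub hy'
      rw [(hasDerivAt_barrier hν0 hy0).deriv]
      refine mul_nonneg (hfac y hy0) ?_
      have := (strictMonoOn_besselLogDeriv hν0).monotoneOn hz₀.le (mem_Ici.2 (le_of_lt hy0)) hy'
      linarith
  rcases le_or_gt (3 / 2) ν with h32 | h32
  -- Here `Φ` increases on all of `(0, ∞)`, and `4z₀ ≤ 2ν - 1` makes the bracket nonnegative at `z₀
  -- ≤ z`.
  · set z₀ := min z ((2 * ν - 1) / 4)
    have hz₀ : 0 < z₀ := lt_min hz (by linarith)
    have hR₀ := besselLogDeriv_nonneg hν0 hz₀.le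
    have h1 : 0 ≤ Φ z₀ := by
      rw [hsign z₀ hz₀]
      have : z₀ ≤ (2 * ν - 1) / 4 := min_le_right _ _
      have : 0 ≤ (2 * ν - 1) * besselLogDeriv ν z₀ := mul_nonneg (by linarith) hR₀
      nlinarith [sq_nonneg (besselLogDeriv ν z₀)]
    rw [← hsign z hz]
    have hle : z₀ ≤ z := min_le_left _ _
    exact h1.trans (hmono z₀ hz₀ (by linarith) self_mem_Ici hle hle)
  · have hc : 3 - 2 * ν ≤ 2 * besselLogDeriv ν ((5 - 2 * ν) / 4) :=
      hcrit.resolve_left (not_le.2 h32)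
    obtain ⟨z₀, hz₀, hzR⟩ : ∃ z₀ ∈ Icc 0 ((5 - 2 * ν) / 4),
        besselLogDeriv ν z₀ = (3 - 2 * ν) / 2 := by
      refine intermediate_value_Icc (by linarith)
        ((continuousOn_besselLogDeriv hν0).mono fun y hy => hy.1) ⟨?_, by linarith⟩
      simp only [besselLogDeriv, zero_mul, zero_div]
      linarith
    have hz₀pos : 0 < z₀ := by
      refine lt_of_le_of_ne hz₀.1 fun h => ?_
      rw [← h] at hzR
      simp only [besselLogDeriv, zero_mul, zero_div] at hzR
      linarith
    -- With `2R = 3 - 2ν` the bracket collapses to `5 - 2ν - 4z₀`.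
    have h1 : 0 ≤ Φ z₀ := by
      rw [hsign z₀ hz₀pos, hzR]
      nlinarith [hz₀.2]
    rw [← hsign z hz]
    rcases le_or_gt z₀ z with h | h
    · exact h1.trans (hmono z₀ hz₀pos (by linarith) self_mem_Ici h h)
    · have hsub : Icc z z₀ ⊆ Ioi 0 := fun y hy => lt_of_lt_of_le hz hy.1
      have hanti : AntitoneOn Φ (Icc z z₀) := by
        refine antitoneOn_of_deriv_nonpos (convex_Icc z z₀) (hcont.mono hsub) (fun y hy => ?_)
          fun y hy => ?_
        · exact (hasDerivAt_barrier hν0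
            (hsub (interior_subset hy))).differentiableAt.differentiableWithinAt
        · have hy' := interior_subset hy
          have hy0 := hsub hy'
          rw [(hasDerivAt_barrier hν0 hy0).deriv]
          refine mul_nonpos_of_nonneg_of_nonpos (hfac y hy0) ?_
          have := (strictMonoOn_besselLogDeriv hν0).monotoneOn (mem_Ici.2 (le_of_lt hy0)) hz₀pos.le hy'.2
          linarith
      exact h1.trans (hanti ⟨le_rfl, h.le⟩ ⟨h.le, le_rfl⟩ h.le)

/-! ### Log-concave densities and their distribution functions -/

/-- The points `x` and `u + (y - x)` are convex combinations of `u` and `y` with interchanged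
weights; add the two concavity inequalities. -/
theorem add_le_add_of_concaveOn {s : Set ℝ} {h : ℝ → ℝ} (hc : ConcaveOn ℝ s h) {u x y : ℝ}
    (hu : u ∈ s) (hy : y ∈ s) (hux : u ≤ x) (hxy : x ≤ y) :
    h y + h u ≤ h x + h (u + (y - x)) := by
  rcases hux.eq_or_lt with rfl | hux'
  · simp [add_comm]
  have hd : 0 < y - u := by linarith
  have h1 : 0 ≤ (y - x) / (y - u) := div_nonneg (by linarith) hd.le
  have h2 : 0 ≤ (x - u) / (y - u) := div_nonneg (by linarith) hd.le
  have h3 : (y - x) / (y - u) + (x - u) / (y - u) = 1 := by field_simp; ring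
  have k1 := hc.2 hu hy h1 h2 h3
  have k2 := hc.2 hu hy h2 h1 (by linarith)
  have e1 : ((y - x) / (y - u)) • u + ((x - u) / (y - u)) • y = x := by
    simp only [smul_eq_mul]; field_simp; ring
  have e2 : ((x - u) / (y - u)) • u + ((y - x) / (y - u)) • y = u + (y - x) := by
    simp only [smul_eq_mul]; field_simp; ring
  rw [e1] at k1
  rw [e2] at k2
  simp only [smul_eq_mul] at k1 k2
  have : (y - x) / (y - u) = 1 - (x - u) / (y - u) := by linarith
  rw [this] at k1 k2
  linarith

/-- The distribution function of a log-concave density on the half-line is log-concave. -/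
theorem logConcaveOn_integral {f : ℝ → ℝ} (hf : Continuous f) (hpos : ∀ t > 0, 0 < f t)
    (hlog : ConcaveOn ℝ (Ioi 0) fun t => Real.log (f t)) :
    LogConcaveOn (Ici 0) fun b => ∫ t in (0 : ℝ)..b, f t := by
  set F : ℝ → ℝ := fun b => ∫ t in (0 : ℝ)..b, f t with hF
  have hF0 : F 0 = 0 := by simp [hF]
  have hFpos : ∀ b > 0, 0 < F b := fun b hb =>
    intervalIntegral.intervalIntegral_pos_of_pos_on (hf.intervalIntegrable _ _)
      (fun t ht => hpos t ht.1) hb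
  have hFnn : ∀ b ≥ 0, 0 ≤ F b := fun b hb => by
    rcases hb.eq_or_lt with h | h
    · rw [← h, hF0]
    · exact (hFpos b h).le
  have hderiv : ∀ b, HasDerivAt F (f b) b := fun b =>
    intervalIntegral.integral_hasDerivAt_right (hf.intervalIntegrable _ _)
      hf.aestronglyMeasurable.stronglyMeasurableAtFilter hf.continuousAt
  have hlogderiv : ∀ b > 0, HasDerivAt (fun b => Real.log (F b)) (f b / F b) b :=
    fun b hb => (hderiv b).log (hFpos b hb).ne'
  have hshift : ∀ u > 0, ∀ x y, u ≤ x → x ≤ y → f y * f u ≤ f x * f (u + (y - x)) := by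
    intro u hu x y hux hxy
    have hx : 0 < x := by linarith
    have hy : 0 < y := by linarith
    have hv : 0 < u + (y - x) := by linarith
    rw [← Real.log_le_log_iff (mul_pos (hpos y hy) (hpos u hu)) (mul_pos (hpos x hx) (hpos _ hv)),
      Real.log_mul (hpos y hy).ne' (hpos u hu).ne', Real.log_mul (hpos x hx).ne' (hpos _ hv).ne']
    exact add_le_add_of_concaveOn hlog hu hy hux hxy
  -- This is the monotonicity of `(log F)'`. The shift inequality, integrated over `u ∈ (0, x)`,
  -- gives `f y * F x ≤ f x * (F y - F (y - x))`.
  have hanti : AntitoneOn (fun b => f b / F b) (Ioi 0) := by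
    intro x hx y hy hxy
    have hx0 : 0 < x := hx
    rw [div_le_div_iff₀ (hFpos y hy) (hFpos x hx)]
    calc f y * F x = ∫ u in (0 : ℝ)..x, f y * f u := by
          rw [intervalIntegral.integral_const_mul]
      _ ≤ ∫ u in (0 : ℝ)..x, f x * f (u + (y - x)) := by
          refine intervalIntegral.integral_mono_on_of_le_Ioo hx0.le
            (Continuous.intervalIntegrable (by fun_prop) _ _)
            (Continuous.intervalIntegrable (by fun_prop) _ _) fun u hu => ?_
          exact hshift u hu.1 x y hu.2.le hxy
      _ = f x * ∫ u in (y - x)..y, f u := by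
          rw [intervalIntegral.integral_const_mul, intervalIntegral.integral_comp_add_right]
          simp
      _ ≤ f x * F y := by
          refine mul_le_mul_of_nonneg_left ?_ (hpos x hx).le
          have := intervalIntegral.integral_add_adjacent_intervals
            (hf.intervalIntegrable (μ := volume) 0 (y - x)) (hf.intervalIntegrable (y - x) y)
          have h2 : 0 ≤ F (y - x) := hFnn _ (sub_nonneg.2 hxy)
          simp only [hF] at h2 ⊢
          linarith
  have hconc : ConcaveOn ℝ (Ioi 0) fun b => Real.log (F b) := by
    refine AntitoneOn.concaveOn_of_deriv (convex_Ioi 0)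
      (fun b hb => (hlogderiv b hb).continuousAt.continuousWithinAt) ?_ ?_
    · rw [interior_Ioi]
      exact fun b hb => (hlogderiv b hb).differentiableAt.differentiableWithinAt
    · rw [interior_Ioi]
      exact hanti.congr fun b hb => (hlogderiv b hb).deriv.symm
  refine ⟨convex_Ici 0, hFnn, ?_⟩
  intro x hx y hy p q hp hq hpq
  have hxy : 0 ≤ p * x + q * y := add_nonneg (mul_nonneg hp hx) (mul_nonneg hq hy)
  -- Zero weights come first because `0 ^ 0 = 1`; with positive weights an endpoint at `0` makes the
  -- left side vanish.
  rcases hp.eq_or_lt with h | hp'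
  · obtain rfl : q = 1 := by linarith
    simp [← h]
  rcases hq.eq_or_lt with h | hq'
  · obtain rfl : p = 1 := by linarith
    simp [← h]
  rcases (mem_Ici.1 hx).eq_or_lt with h | hx'
  · rw [← h, hF0, Real.zero_rpow hp'.ne', zero_mul]
    simpa [← h] using hFnn _ hxy
  rcases (mem_Ici.1 hy).eq_or_lt with h | hy'
  · rw [← h, hF0, Real.zero_rpow hq'.ne', mul_zero]
    simpa [← h] using hFnn _ hxy
  have hz : 0 < p * x + q * y := add_pos (mul_pos hp' hx') (mul_pos hq' hy')
  have hFx := hFpos x hx'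
  have hFy := hFpos y hy'
  rw [← Real.log_le_log_iff (by positivity) (hFpos _ hz), Real.log_mul (by positivity)
    (by positivity), Real.log_rpow hFx, Real.log_rpow hFy]
  exact hconc.2 hx' hy' hp hq hpq

/-! ### The Marcum function as a tail of the noncentral chi density -/

/-- The noncentral chi density with `2 ν` degrees of freedom and noncentrality parameter `a`. -/
noncomputable def chiDensity (ν a t : ℝ) : ℝ :=
  2 ^ (1 - ν) * Real.exp (-a ^ 2 / 2) *
    (t ^ (2 * ν - 1) * Real.exp (-t ^ 2 / 2) * besselSeries ν (a ^ 2 * t ^ 2 / 4))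

theorem marcumIntegrand_eq_chiDensity {ν a t : ℝ} (ha : 0 < a) (ht : 0 < t) :
    marcumIntegrand ν a t = chiDensity ν a t := by
  unfold marcumIntegrand chiDensity
  rw [besselI_sub_one_eq (mul_pos ha ht), mul_pow, Real.div_rpow (by positivity) (by norm_num),
    Real.mul_rpow ha.le ht.le, show (2 : ℝ) * ν - 1 = ν + (ν - 1) by ring, Real.rpow_add ht,
    show -(t ^ 2 + a ^ 2) / 2 = -a ^ 2 / 2 + -t ^ 2 / 2 by ring, Real.exp_add,
    show 1 - ν = -(ν - 1) by ring, Real.rpow_neg (by norm_num)]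
  have h1 := (Real.rpow_pos_of_pos ha (ν - 1)).ne'
  field_simp

theorem continuous_uncurry_chiDensity {ν : ℝ} (hν : 1 / 2 ≤ ν) :
    Continuous (Function.uncurry (chiDensity ν)) := by
  have hp := Real.continuous_rpow_const (by linarith : 0 ≤ 2 * ν - 1)
  have hJ := continuous_besselSeries (by linarith : 0 < ν)
  unfold chiDensity Function.uncurry
  fun_prop

theorem chiDensity_pos {ν a t : ℝ} (hν : 0 < ν) (ht : 0 < t) : 0 < chiDensity ν a t := by
  have h1 := Real.rpow_pos_of_pos ht (2 * ν - 1)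
  have h2 := besselSeries_pos hν (by positivity : 0 ≤ a ^ 2 * t ^ 2 / 4)
  unfold chiDensity
  positivity

/-- The density is a Poisson mixture, with mean `a²/2`, of central chi densities with `2(ν + k)`
degrees of freedom. The `k`-th term integrates to the `k`-th Poisson weight. -/
theorem integral_chiDensity {ν : ℝ} (hν : 0 < ν) (a : ℝ) :
    ∫ t in Ioi 0, chiDensity ν a t = 1 := by
  set C : ℕ → ℝ := fun k => 2 ^ (1 - ν) * Real.exp (-a ^ 2 / 2) *
    ((a ^ 2 / 4) ^ k / (k.factorial * Real.Gamma (ν + k))) with hC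
  set F : ℕ → ℝ → ℝ := fun k t =>
    C k * (t ^ (2 * (ν + k) - 1) * Real.exp (-(1 / 2) * t ^ (2 : ℝ))) with hF
  have hGpos : ∀ k : ℕ, 0 < Real.Gamma (ν + k) := fun k => Real.Gamma_pos_of_pos (by positivity)
  have hCnn : ∀ k, 0 ≤ C k := fun k => by
    have := hGpos k
    simp only [hC]
    positivity
  have hF_int : ∀ k, IntegrableOn (F k) (Ioi 0) := fun k => by
    have hk : (0 : ℝ) ≤ k := k.cast_nonneg
    exact (integrableOn_rpow_mul_exp_neg_mul_rpow (by linarith) (by norm_num)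
      (by norm_num)).const_mul (C k)
  have hval : ∀ k, ∫ t in Ioi 0, F k t =
      Real.exp (-a ^ 2 / 2) * ((a ^ 2 / 2) ^ k / k.factorial) := fun k => by
    have hk : (0 : ℝ) ≤ k := k.cast_nonneg
    simp only [hF]
    rw [integral_const_mul, integral_rpow_mul_exp_neg_mul_rpow (by norm_num) (by linarith)
      (by norm_num), show (2 * (ν + k) - 1 + 1) / 2 = ν + k by ring,
      show -(2 * (ν + k) - 1 + 1) / 2 = -(ν + (k : ℝ)) by ring, one_div,
      Real.inv_rpow (by norm_num), Real.rpow_neg (by norm_num), inv_inv,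
      Real.rpow_add (by norm_num), Real.rpow_natCast]
    simp only [hC]
    have := (hGpos k).ne'
    rw [Real.rpow_sub (by norm_num), Real.rpow_one, div_pow, div_pow,
      show (4 : ℝ) ^ k = 2 ^ k * 2 ^ k by rw [← mul_pow]; norm_num]
    have h2 := (Real.rpow_pos_of_pos (by norm_num : (0 : ℝ) < 2) ν).ne'
    field_simp
  have hnorm : ∀ k, ∫ t in Ioi 0, ‖F k t‖ = ∫ t in Ioi 0, F k t := fun k => by
    refine setIntegral_congr_fun measurableSet_Ioi fun t ht => Real.norm_of_nonneg ?_
    have := Real.rpow_nonneg (le_of_lt ht) (2 * (ν + k) - 1)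
    have := hCnn k
    simp only [hF]
    positivity
  have hexp : HasSum (fun k : ℕ => Real.exp (-a ^ 2 / 2) * ((a ^ 2 / 2) ^ k / k.factorial)) 1 := by
    have h := (NormedSpace.expSeries_div_hasSum_exp (a ^ 2 / 2)).mul_left (Real.exp (-a ^ 2 / 2))
    rwa [← Real.exp_eq_exp_ℝ, ← Real.exp_add, show -a ^ 2 / 2 + a ^ 2 / 2 = 0 by ring,
      Real.exp_zero] at h
  have hsum := hasSum_integral_of_summable_integral_norm (μ := volume.restrict (Ioi 0)) hF_int
    (by simp only [hnorm, hval]; exact hexp.summable)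
  simp only [hval] at hsum
  rw [← hsum.unique hexp]
  refine setIntegral_congr_fun measurableSet_Ioi fun t ht => ?_
  have ht0 : 0 < t := ht
  simp only [chiDensity, besselSeries, hF, hC]
  rw [← tsum_mul_left, ← tsum_mul_left]
  refine tsum_congr fun k => ?_
  rw [show 2 * (ν + k) - 1 = (2 * ν - 1) + (2 * k : ℕ) by push_cast; ring, Real.rpow_add ht0,
    Real.rpow_natCast, Real.rpow_two, pow_mul,
    show -(1 / 2) * t ^ 2 = -t ^ 2 / 2 by ring, show a ^ 2 * t ^ 2 / 4 = a ^ 2 / 4 * t ^ 2 by ring,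
    mul_pow]
  ring

theorem integrableOn_chiDensity {ν : ℝ} (hν : 0 < ν) (a : ℝ) :
    IntegrableOn (chiDensity ν a) (Ioi 0) := by
  by_contra h
  have := integral_chiDensity hν a
  -- The integral of a non-integrable function is `0` by convention, against the value `1`.
  rw [integral_undef h] at this
  norm_num at this

theorem marcumIntegral_eq {ν a b : ℝ} (hν : 0 < ν) (ha : 0 < a) (hb : 0 ≤ b) :
    marcumIntegral ν a b = 1 - ∫ t in (0 : ℝ)..b, chiDensity ν a t := by
  have h1 : marcumIntegral ν a b = ∫ t in Ioi b, chiDensity ν a t :=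
    setIntegral_congr_fun measurableSet_Ioi fun t ht =>
      marcumIntegrand_eq_chiDensity ha (lt_of_le_of_lt hb ht)
  have hint := integrableOn_chiDensity hν a
  rw [h1, ← integral_chiDensity hν a, ← intervalIntegral.integral_Ioi_sub_Ioi hint hb]
  ring

theorem marcumQ_eq {ν a b : ℝ} (hν : 1 / 2 ≤ ν) (ha : 0 ≤ a) (hb : 0 ≤ b) :
    marcumQ ν a b = 1 - ∫ t in (0 : ℝ)..b, chiDensity ν a t := by
  have hν0 : 0 < ν := by linarith
  unfold marcumQ
  split_ifs with h
  · subst h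
    refine Tendsto.limUnder_eq ?_
    -- The density, unlike the integrand with its power of `a` in the denominator, extends
    -- continuously to `a = 0`, so the limit is its value there.
    have hc : Continuous fun a' => 1 - ∫ t in (0 : ℝ)..b, chiDensity ν a' t :=
      continuous_const.sub (intervalIntegral.continuous_parametric_intervalIntegral_of_continuous'
        (continuous_uncurry_chiDensity hν) 0 b)
    refine ((hc.tendsto 0).mono_left nhdsWithin_le_nhds).congr' ?_
    filter_upwards [self_mem_nhdsWithin] with a' ha'
    exact (marcumIntegral_eq hν0 ha' hb).symm
  · exact marcumIntegral_eq hν0 (lt_of_le_of_ne ha (Ne.symm h)) hb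

/-- The hypothesis says that `t²` times the second derivative of the log-density is nonpositive; the
recurrence expresses that derivative through `besselLogDeriv` alone. -/
theorem concaveOn_log_chiDensity {ν a : ℝ} (hν : 1 / 2 ≤ ν)
    (h : ∀ t > 0, 4 * (a ^ 2 * t ^ 2 / 4) - 2 * (2 * ν - 1) * besselLogDeriv ν (a ^ 2 * t ^ 2 / 4) -
      4 * besselLogDeriv ν (a ^ 2 * t ^ 2 / 4) ^ 2 ≤ 2 * ν - 1 + t ^ 2) :
    ConcaveOn ℝ (Ioi 0) fun t => Real.log (chiDensity ν a t) := by
  have hν0 : 0 < ν := by linarith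
  have hJ : ∀ t, 0 < besselSeries ν (a ^ 2 * t ^ 2 / 4) := fun t =>
    besselSeries_pos hν0 (by positivity)
  have hz : ∀ t, HasDerivAt (fun t : ℝ => a ^ 2 * t ^ 2 / 4) (a ^ 2 * t / 2) t := fun t =>
    (((hasDerivAt_pow 2 t).const_mul (a ^ 2)).div_const 4).congr_deriv (by push_cast; ring)
  have hJ' : ∀ t, HasDerivAt (fun t => besselSeries ν (a ^ 2 * t ^ 2 / 4))
      (besselSeries (ν + 1) (a ^ 2 * t ^ 2 / 4) * (a ^ 2 * t / 2)) t := fun t =>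
    (hasDerivAt_besselSeries hν0 _).comp t (hz t)
  have hJ1' : ∀ t, HasDerivAt (fun t => besselSeries (ν + 1) (a ^ 2 * t ^ 2 / 4))
      (besselSeries (ν + 1 + 1) (a ^ 2 * t ^ 2 / 4) * (a ^ 2 * t / 2)) t := fun t =>
    (hasDerivAt_besselSeries (by linarith : 0 < ν + 1) _).comp t (hz t)
  have hlog : EqOn (fun t => (2 * ν - 1) * Real.log t - t ^ 2 / 2 +
      Real.log (besselSeries ν (a ^ 2 * t ^ 2 / 4)) +
      Real.log (2 ^ (1 - ν) * Real.exp (-a ^ 2 / 2)))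
      (fun t => Real.log (chiDensity ν a t)) (Ioi 0) := by
    intro t ht
    have ht0 : 0 < t := ht
    have h1 := (Real.rpow_pos_of_pos ht0 (2 * ν - 1)).ne'
    have h2 := (hJ t).ne'
    simp only [chiDensity]
    have h3 : (2 : ℝ) ^ (1 - ν) * Real.exp (-a ^ 2 / 2) ≠ 0 := by positivity
    rw [Real.log_mul h3 (by positivity), Real.log_mul (by positivity) h2,
      Real.log_mul h1 (by positivity), Real.log_rpow ht0, Real.log_exp]
    ring
  refine ConcaveOn.congr ?_ hlog
  refine ConcaveOn.add_const ?_ _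
  have hd1 : ∀ t > 0, HasDerivAt (fun t => (2 * ν - 1) * Real.log t - t ^ 2 / 2 +
      Real.log (besselSeries ν (a ^ 2 * t ^ 2 / 4)))
      ((2 * ν - 1) / t - t + a ^ 2 / 2 * (t * besselSeries (ν + 1) (a ^ 2 * t ^ 2 / 4)) /
        besselSeries ν (a ^ 2 * t ^ 2 / 4)) t := fun t ht =>
    ((((Real.hasDerivAt_log ht.ne').const_mul (2 * ν - 1)).sub
      ((hasDerivAt_pow 2 t).div_const 2)).add ((hJ' t).log (hJ t).ne')).congr_deriv
      (by push_cast; ring)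
  have hd2 : ∀ t > 0, HasDerivAt (fun t => (2 * ν - 1) / t - t +
      a ^ 2 / 2 * (t * besselSeries (ν + 1) (a ^ 2 * t ^ 2 / 4)) /
        besselSeries ν (a ^ 2 * t ^ 2 / 4))
      ((4 * (a ^ 2 * t ^ 2 / 4) - 2 * (2 * ν - 1) * besselLogDeriv ν (a ^ 2 * t ^ 2 / 4) -
      4 * besselLogDeriv ν (a ^ 2 * t ^ 2 / 4) ^ 2 - (2 * ν - 1 + t ^ 2)) / t ^ 2) t := by
    intro t ht
    have hrec := mul_besselSeries_add_two hν0 (a ^ 2 * t ^ 2 / 4)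
    have hJt := (hJ t).ne'
    refine ((((hasDerivAt_inv ht.ne').const_mul (2 * ν - 1)).sub (hasDerivAt_id t)).add
      ((((hasDerivAt_id t).mul (hJ1' t)).const_mul (a ^ 2 / 2)).div (hJ' t) hJt)).congr_deriv ?_
    simp only [besselLogDeriv, Pi.mul_apply, id_eq]
    generalize besselSeries ν (a ^ 2 * t ^ 2 / 4) = u at *
    generalize besselSeries (ν + 1) (a ^ 2 * t ^ 2 / 4) = v at *
    generalize besselSeries (ν + 1 + 1) (a ^ 2 * t ^ 2 / 4) = w at *
    have hw : a ^ 2 * t ^ 2 * w = 4 * (u - ν * v) := by linarith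
    field_simp
    linear_combination (4 * a ^ 2 * t ^ 2 * u) * hw
  refine concaveOn_of_hasDerivWithinAt2_nonpos (convex_Ioi 0)
    (fun t ht => (hd1 t ht).continuousAt.continuousWithinAt)
    (f' := fun t => (2 * ν - 1) / t - t + a ^ 2 / 2 *
      (t * besselSeries (ν + 1) (a ^ 2 * t ^ 2 / 4)) / besselSeries ν (a ^ 2 * t ^ 2 / 4))
    (f'' := fun t => (4 * (a ^ 2 * t ^ 2 / 4) -
      2 * (2 * ν - 1) * besselLogDeriv ν (a ^ 2 * t ^ 2 / 4) -
      4 * besselLogDeriv ν (a ^ 2 * t ^ 2 / 4) ^ 2 - (2 * ν - 1 + t ^ 2)) / t ^ 2)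
    ?_ ?_ ?_
  · exact fun t ht => (hd1 t (interior_subset ht)).hasDerivWithinAt
  · exact fun t ht => (hd2 t (interior_subset ht)).hasDerivWithinAt
  · exact fun t ht => div_nonpos_of_nonpos_of_nonneg
      (sub_nonpos.2 (h t (interior_subset ht))) (by positivity)

theorem logConcaveOn_one_sub_marcumQ {ν a : ℝ} (hν : 1 / 2 ≤ ν) (ha : 0 ≤ a)
    (h : ∀ t > 0, 4 * (a ^ 2 * t ^ 2 / 4) - 2 * (2 * ν - 1) * besselLogDeriv ν (a ^ 2 * t ^ 2 / 4) -
      4 * besselLogDeriv ν (a ^ 2 * t ^ 2 / 4) ^ 2 ≤ 2 * ν - 1 + t ^ 2) :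
    LogConcaveOn (Ici 0) fun b => 1 - marcumQ ν a b := by
  have hcont : Continuous (chiDensity ν a) :=
    (continuous_uncurry_chiDensity hν).comp (Continuous.prodMk_right a)
  obtain ⟨h1, h2, h3⟩ := logConcaveOn_integral hcont
    (fun t ht => chiDensity_pos (by linarith) ht) (concaveOn_log_chiDensity hν h)
  have he : ∀ b ∈ Ici (0 : ℝ), 1 - marcumQ ν a b = ∫ t in (0 : ℝ)..b, chiDensity ν a t :=
    fun b hb => by rw [marcumQ_eq hν ha hb]; ring
  refine ⟨h1, fun b hb => (h2 b hb).trans_eq (he b hb).symm, fun x hx y hy p q hp hq hpq => ?_⟩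
  have hxy : p * x + q * y ∈ Ici (0 : ℝ) := add_nonneg (mul_nonneg hp hx) (mul_nonneg hq hy)
  simp only [he x hx, he y hy, he _ hxy]
  exact h3 x hx y hy p q hp hq hpq

theorem logConcaveOn_one_sub_marcumQ_of_le_one {ν a : ℝ} (hν : 1 / 2 ≤ ν) (ha : 0 ≤ a)
    (ha1 : a ≤ 1) : LogConcaveOn (Ici 0) fun b => 1 - marcumQ ν a b := by
  refine logConcaveOn_one_sub_marcumQ hν ha fun t ht => ?_
  have hR := besselLogDeriv_nonneg (by linarith : 0 < ν) (by positivity : 0 ≤ a ^ 2 * t ^ 2 / 4)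
  have h1 : 0 ≤ (2 * ν - 1) * besselLogDeriv ν (a ^ 2 * t ^ 2 / 4) :=
    mul_nonneg (by linarith) hR
  have h2 : a ^ 2 * t ^ 2 ≤ t ^ 2 :=
    mul_le_of_le_one_left (sq_nonneg t) (pow_le_one₀ ha ha1)
  nlinarith [sq_nonneg (besselLogDeriv ν (a ^ 2 * t ^ 2 / 4))]

theorem logConcaveOn_one_sub_marcumQ_of_critical {ν a : ℝ} (hν : 1 / 2 ≤ ν)
    (hcrit : 3 / 2 ≤ ν ∨ 3 - 2 * ν ≤ 2 * besselLogDeriv ν ((5 - 2 * ν) / 4)) (ha : 0 ≤ a) :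
    LogConcaveOn (Ici 0) fun b => 1 - marcumQ ν a b := by
  -- The barrier inequality needs `z = a²t²/4 > 0`, so `a = 0` is covered by the case `a ≤ 1`.
  rcases ha.eq_or_lt with rfl | ha'
  · exact logConcaveOn_one_sub_marcumQ_of_le_one hν le_rfl zero_le_one
  refine logConcaveOn_one_sub_marcumQ hν ha fun t ht => ?_
  have := besselLogDeriv_barrier_nonneg hν hcrit (by positivity : 0 < a ^ 2 * t ^ 2 / 4)
  nlinarith [sq_nonneg t]

/-! ### The critical equation as a power series -/

/-- The coefficients of `critTerm`. -/
noncomputable def critCoeff (j : ℕ) (ν : ℝ) : ℝ :=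
  ((5 - 2 * ν) / 4) ^ (j + 2) / ((j + 2).factorial * ∏ i ∈ Finset.range (j + 1), (ν + 1 + i))

/-- The terms of the series that defines `critFun`. -/
noncomputable def critTerm (j : ℕ) (ν : ℝ) : ℝ :=
  (2 * ν + 2 * j + 1) * critCoeff j ν

/-- A function with the sign of `2 R - (3 - 2 ν)`, where `R = besselLogDeriv ν ((5 - 2 ν) / 4)`. -/
noncomputable def critFun (ν : ℝ) : ℝ :=
  ν ^ 2 - 5 / 4 + ∑' j : ℕ, critTerm j ν

theorem Gamma_add_nat_eq_prod {x : ℝ} (hx : 0 < x) (n : ℕ) :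
    Real.Gamma (x + n) = Real.Gamma x * ∏ i ∈ Finset.range n, (x + i) := by
  induction n with
  | zero => simp
  | succ n ih =>
    have hpos : 0 < x + n := by positivity
    rw [Finset.prod_range_succ, ← mul_assoc, ← ih, Nat.cast_succ, ← add_assoc,
      Real.Gamma_add_one hpos.ne']
    ring

/-- With `z = (5 - 2ν)/4`, the `k`-th term on the right is `(2k - 3 + 2ν) z ^ k Γ(ν+1) / (k!
Γ(ν+k))`. The terms `k = 0, 1` add up to `ν² - 5/4`, and `k = j + 2` gives `critTerm j`. -/
theorem critFun_eq {ν : ℝ} (hν : 0 < ν) :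
    critFun ν = Real.Gamma (ν + 1) *
      (2 * ((5 - 2 * ν) / 4 * besselSeries (ν + 1) ((5 - 2 * ν) / 4)) -
        (3 - 2 * ν) * besselSeries ν ((5 - 2 * ν) / 4)) := by
  set z := (5 - 2 * ν) / 4 with hz
  have hJ : HasSum (fun k : ℕ => z ^ k / ((k.factorial : ℝ) * Real.Gamma (ν + k)))
      (besselSeries ν z) := (summable_besselSeries hν z).hasSum
  have hJ1 : HasSum (fun k : ℕ => (k : ℝ) * (z ^ k / ((k.factorial : ℝ) * Real.Gamma (ν + k))))
      (z * besselSeries (ν + 1) z) := by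
    rw [← hasSum_nat_add_iff' 1]
    simp only [Finset.range_one, Finset.sum_singleton, Nat.cast_zero, zero_mul, sub_zero]
    refine ((summable_besselSeries (by linarith : 0 < ν + 1) z).hasSum.mul_left z).congr_fun ?_
    intro k
    rw [show ν + ((k + 1 : ℕ) : ℝ) = ν + 1 + k by push_cast; ring, Nat.factorial_succ]
    have hk : ((k : ℝ) + 1) ≠ 0 := by positivity
    have hG := (Real.Gamma_pos_of_pos (by positivity : 0 < ν + 1 + (k : ℝ))).ne'
    push_cast
    field_simp
    ring
  have hG1 := (Real.Gamma_pos_of_pos (by linarith : 0 < ν + 1)).ne'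
  have hG0 := (Real.Gamma_pos_of_pos hν).ne'
  have hS := (((hJ1.mul_left 2).sub (hJ.mul_left (3 - 2 * ν))).mul_left (Real.Gamma (ν + 1)))
  rw [← hasSum_nat_add_iff' 2] at hS
  have hT : ∑' j : ℕ, critTerm j ν = _ := (hS.congr_fun fun j => ?_).tsum_eq
  · rw [critFun, hT]
    simp only [Finset.sum_range_succ, Finset.range_zero, Finset.sum_empty]
    simp only [Nat.cast_zero, Nat.cast_one, add_zero, Nat.factorial, Real.Gamma_add_one hν.ne',
      pow_zero, pow_one]
    push_cast
    field_simp
    rw [hz]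
    ring
  · rw [critTerm, critCoeff, ← hz,
      show ν + ((j + 2 : ℕ) : ℝ) = ν + 1 + (j + 1 : ℕ) by push_cast; ring,
      Gamma_add_nat_eq_prod (by linarith : 0 < ν + 1)]
    have hP : 0 < ∏ i ∈ Finset.range (j + 1), (ν + 1 + (i : ℝ)) :=
      Finset.prod_pos fun i _ => by positivity
    have := hP.ne'
    push_cast
    field_simp
    ring

theorem critFun_nonneg_iff {ν : ℝ} (h : 1 / 2 ≤ ν) (h' : ν ≤ 3 / 2) :
    0 ≤ critFun ν ↔ 3 - 2 * ν ≤ 2 * besselLogDeriv ν ((5 - 2 * ν) / 4) := by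
  have hν : 0 < ν := by linarith
  have hJ := besselSeries_pos hν (by linarith : 0 ≤ (5 - 2 * ν) / 4)
  rw [critFun_eq hν, mul_nonneg_iff_of_pos_left (Real.Gamma_pos_of_pos (by linarith)),
    besselLogDeriv, mul_div_assoc', le_div_iff₀ hJ, sub_nonneg]

/-- For `x = √(5 - 2ν)` one has `x²/4 = (5 - 2ν)/4`, and `x` times the Bessel quotient is `2R` at
that point. -/
theorem isCriticalOrder_iff {ν : ℝ} :
    IsCriticalOrder ν ↔ ν ∈ Ioo (1 / 2 : ℝ) (3 / 2) ∧ critFun ν = 0 := by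
  refine and_congr_right fun h => ?_
  have hν : 0 < ν := by linarith [h.1]
  have hs : 0 < 5 - 2 * ν := by linarith [h.2]
  have hx := Real.sqrt_pos.2 hs
  have hx2 : Real.sqrt (5 - 2 * ν) ^ 2 = 5 - 2 * ν := Real.sq_sqrt hs.le
  have hJ := (besselSeries_pos hν (by linarith : 0 ≤ (5 - 2 * ν) / 4)).ne'
  have hG := (Real.Gamma_pos_of_pos (by linarith : 0 < ν + 1)).ne'
  have e : besselI ν (Real.sqrt (5 - 2 * ν)) = (Real.sqrt (5 - 2 * ν) / 2) ^ ν *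
      besselSeries (ν + 1) (Real.sqrt (5 - 2 * ν) ^ 2 / 4) := by
    simpa using besselI_sub_one_eq (ν := ν + 1) hx
  have hp := (Real.rpow_pos_of_pos (half_pos hx) ν).ne'
  rw [e, besselI_sub_one_eq hx, hx2, critFun_eq hν, Real.rpow_sub_one (half_pos hx).ne',
    mul_eq_zero, or_iff_right hG, sub_eq_zero, div_eq_div_iff (by positivity) hx.ne']
  generalize besselSeries (ν + 1) ((5 - 2 * ν) / 4) = v at *
  generalize besselSeries ν ((5 - 2 * ν) / 4) = u at *
  field_simp
  rw [hx2]
  constructor <;> intro h <;> linarith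

theorem critCoeff_succ {ν : ℝ} (hν : 0 < ν) (j : ℕ) :
    critCoeff (j + 1) ν = critCoeff j ν * ((5 - 2 * ν) / 4 / (ν + j + 2)) / (j + 3) := by
  have hP : (∏ i ∈ Finset.range (j + 1), (ν + 1 + (i : ℝ))) ≠ 0 :=
    (Finset.prod_pos fun i _ => by positivity).ne'
  have h1 : ν + j + 2 ≠ 0 := by positivity
  have h2 : ν + 1 + ((j : ℝ) + 1) ≠ 0 := by positivity
  have h3 : ν + 1 + ((j : ℝ) + 1) = ν + j + 2 := by ring
  simp only [critCoeff]
  rw [Finset.prod_range_succ _ (j + 1), Nat.factorial_succ (j + 2)]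
  push_cast
  rw [h3]
  field_simp
  ring

theorem critCoeff_pos {ν : ℝ} (hν : ν ∈ Icc (1 / 2 : ℝ) (3 / 2)) (j : ℕ) :
    0 < critCoeff j ν := by
  have h1 := hν.1
  have hz : 0 < (5 - 2 * ν) / 4 := by linarith [hν.2]
  have hP : 0 < ∏ i ∈ Finset.range (j + 1), (ν + 1 + (i : ℝ)) :=
    Finset.prod_pos fun i _ => by positivity
  unfold critCoeff
  positivity

theorem critTerm_pos {ν : ℝ} (hν : ν ∈ Icc (1 / 2 : ℝ) (3 / 2)) (j : ℕ) : 0 < critTerm j ν :=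
  mul_pos (by have := hν.1; positivity) (critCoeff_pos hν j)

theorem critRatio_mem {ν : ℝ} (hν : ν ∈ Icc (1 / 2 : ℝ) (3 / 2)) (j : ℕ) :
    0 < (5 - 2 * ν) / 4 / (ν + j + 2) ∧ (5 - 2 * ν) / 4 / (ν + j + 2) ≤ 1 / (j + 5 / 2) := by
  have h1 := hν.1
  have h2 := hν.2
  have hj : (0 : ℝ) ≤ j := j.cast_nonneg
  refine ⟨div_pos (by linarith) (by linarith), ?_⟩
  exact div_le_div₀ (by norm_num) (by linarith) (by positivity) (by linarith)

/-- The ratio `1/16` is available only from index `2` on: at `ν = 1/2` the quotient of terms `2` and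
`1` is larger. -/
theorem critTerm_add_two_succ_le {ν : ℝ} (hν : ν ∈ Icc (1 / 2 : ℝ) (3 / 2)) (j : ℕ) :
    critTerm (j + 1 + 2) ν ≤ critTerm (j + 2) ν / 16 := by
  have h1 := hν.1
  have h2 := hν.2
  have hj : (0 : ℝ) ≤ j := j.cast_nonneg
  have hc := critCoeff_pos hν (j + 2)
  obtain ⟨hr0, hr⟩ := critRatio_mem hν (j + 2)
  simp only [critTerm]
  rw [show j + 1 + 2 = (j + 2) + 1 by ring, critCoeff_succ (by linarith)]
  set r := (5 - 2 * ν) / 4 / (ν + ((j + 2 : ℕ) : ℝ) + 2)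
  have hr' : r ≤ 2 / 9 := hr.trans (by
    rw [div_le_div_iff₀ (by positivity) (by norm_num)]; push_cast; linarith)
  push_cast
  have key : (2 * ν + 2 * (j + 2 + 1) + 1) * (r / (j + 2 + 3)) ≤
      (2 * ν + 2 * (j + 2) + 1) / 16 := by
    rw [mul_div_assoc', div_le_div_iff₀ (by positivity) (by norm_num)]
    have : (2 * ν + 2 * (j + 2 + 1) + 1) * r ≤ (2 * ν + 2 * (j + 2 + 1) + 1) * (2 / 9) := by
      gcongr
    nlinarith [mul_nonneg hj hj, mul_nonneg hj (by linarith : (0 : ℝ) ≤ ν - 1 / 2)]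
  calc _ = ((2 * ν + 2 * ((j : ℝ) + 2 + 1) + 1) * (r / (j + 2 + 3))) * critCoeff (j + 2) ν := by
        ring
    _ ≤ ((2 * ν + 2 * ((j : ℝ) + 2) + 1) / 16) * critCoeff (j + 2) ν := by gcongr
    _ = _ := by ring

theorem critTerm_add_le {ν : ℝ} (hν : ν ∈ Icc (1 / 2 : ℝ) (3 / 2)) (n j : ℕ) :
    critTerm (j + (n + 2)) ν ≤ critTerm (n + 2) ν * (1 / 16) ^ j := by
  induction j with
  | zero => simp
  | succ j ih =>
    have := critTerm_add_two_succ_le hν (j + n)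
    rw [show j + 1 + (n + 2) = j + n + 1 + 2 by ring, pow_succ]
    rw [show j + (n + 2) = j + n + 2 by ring] at ih
    linarith

theorem summable_critTerm {ν : ℝ} (hν : ν ∈ Icc (1 / 2 : ℝ) (3 / 2)) :
    Summable fun j => critTerm j ν := by
  rw [← summable_nat_add_iff (0 + 2)]
  exact Summable.of_nonneg_of_le (fun j => (critTerm_pos hν _).le) (critTerm_add_le hν 0)
    ((summable_geometric_of_lt_one (by norm_num) (by norm_num)).mul_left _)

theorem sum_le_tsum_critTerm {ν : ℝ} (hν : ν ∈ Icc (1 / 2 : ℝ) (3 / 2)) (n : ℕ) :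
    ∑ j ∈ Finset.range n, critTerm j ν ≤ ∑' j, critTerm j ν :=
  (summable_critTerm hν).sum_le_tsum _ fun j _ => (critTerm_pos hν j).le

theorem tsum_critTerm_le {ν : ℝ} (hν : ν ∈ Icc (1 / 2 : ℝ) (3 / 2)) (n : ℕ) :
    ∑' j, critTerm j ν ≤
      ∑ j ∈ Finset.range (n + 2), critTerm j ν + critTerm (n + 2) ν * (16 / 15) := by
  rw [← (summable_critTerm hν).sum_add_tsum_nat_add (n + 2)]
  gcongr
  have hg : HasSum (fun j : ℕ => critTerm (n + 2) ν * (1 / 16 : ℝ) ^ j)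
      (critTerm (n + 2) ν * (16 / 15)) := by
    have := (hasSum_geometric_of_lt_one (r := (1 / 16 : ℝ)) (by norm_num)
      (by norm_num)).mul_left (critTerm (n + 2) ν)
    norm_num at this ⊢
    exact this
  exact hasSum_le (critTerm_add_le hν n)
    (((summable_nat_add_iff (n + 2)).2 (summable_critTerm hν)).hasSum) hg

/-! ### Monotonicity and continuity of the critical function -/

theorem continuousOn_critCoeff (j : ℕ) : ContinuousOn (critCoeff j) (Icc (1 / 2 : ℝ) (3 / 2)) := by
  unfold critCoeff
  refine ContinuousOn.div (by fun_prop) (by fun_prop) fun ν hν => ?_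
  have h1 := hν.1
  have hP : 0 < ∏ i ∈ Finset.range (j + 1), (ν + 1 + (i : ℝ)) :=
    Finset.prod_pos fun i _ => by positivity
  positivity

/-- The size and the rate of decrease of the coefficients are propagated together through
`critCoeff_succ`, by the product rule for differences. Two steps from index `0` give the constants
at index `2`, after which each step gains a factor below `1/16`. -/
theorem critCoeff_two_add_bounds {x y : ℝ} (hx : x ∈ Icc (1 / 2 : ℝ) (3 / 2))
    (hy : y ∈ Icc (1 / 2 : ℝ) (3 / 2)) (hxy : x ≤ y) (j : ℕ) :
    critCoeff (j + 2) y ≤ 1 / 300 * (1 / 16) ^ j ∧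
      critCoeff (j + 2) x - critCoeff (j + 2) y ≤ 11 / 1000 * (1 / 16) ^ j * (y - x) := by
  have hd : 0 ≤ y - x := by linarith
  have hratio : ∀ j : ℕ, (5 - 2 * x) / 4 / (x + j + 2) - (5 - 2 * y) / 4 / (y + j + 2) ≤
      (9 + 2 * j) / (4 * (j + 5 / 2) ^ 2) * (y - x) := fun j => by
    have hj : (0 : ℝ) ≤ j := j.cast_nonneg
    have h1 : (j : ℝ) + 5 / 2 ≤ x + j + 2 := by linarith [hx.1]
    have h2 : (j : ℝ) + 5 / 2 ≤ y + j + 2 := by linarith [hy.1]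
    have h3 : 0 < x + j + 2 := by linarith
    have h4 : 0 < y + j + 2 := by linarith
    calc _ = (9 + 2 * j) / (4 * ((x + j + 2) * (y + j + 2))) * (y - x) := by field_simp; ring
      _ ≤ _ := by rw [pow_two]; gcongr
  -- one step of the recursion for the bounds
  have step : ∀ (j : ℕ) (b c : ℝ), 0 ≤ b → critCoeff j y ≤ b →
      critCoeff j x - critCoeff j y ≤ c * (y - x) → 0 ≤ c →
      critCoeff (j + 1) y ≤ b * (1 / (j + 5 / 2)) / (j + 3) ∧
      critCoeff (j + 1) x - critCoeff (j + 1) y ≤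
        (c * (1 / (j + 5 / 2)) + b * ((9 + 2 * j) / (4 * (j + 5 / 2) ^ 2))) / (j + 3) *
          (y - x) := by
    intro j b c hb h1 h2 hc
    have hcy := critCoeff_pos hy j
    obtain ⟨hrx0, hrx⟩ := critRatio_mem hx j
    obtain ⟨hry0, hry⟩ := critRatio_mem hy j
    have hr := hratio j
    rw [critCoeff_succ (by linarith [hx.1] : 0 < x), critCoeff_succ (by linarith [hy.1] : 0 < y)]
    set rx := (5 - 2 * x) / 4 / (x + j + 2)
    set ry := (5 - 2 * y) / 4 / (y + j + 2)
    refine ⟨by gcongr, ?_⟩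
    rw [← sub_div, div_mul_eq_mul_div]
    gcongr
    calc critCoeff j x * rx - critCoeff j y * ry
        = (critCoeff j x - critCoeff j y) * rx + critCoeff j y * (rx - ry) := by ring
      _ ≤ c * (y - x) * (1 / (j + 5 / 2)) +
          b * ((9 + 2 * j) / (4 * (j + 5 / 2) ^ 2) * (y - x)) := by
          refine add_le_add ?_ ?_
          · exact (mul_le_mul_of_nonneg_right h2 hrx0.le).trans (by gcongr)
          · exact (mul_le_mul_of_nonneg_left hr hcy.le).trans (by gcongr)
      _ = _ := by ring
  -- Both constants are the extremes at `ν = 1/2`: the value, and the absolute slope of the form in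
  -- `e2`.
  have base : critCoeff 0 y ≤ 1 / 3 ∧ critCoeff 0 x - critCoeff 0 y ≤ 5 / 9 * (y - x) := by
    have hx1 : 0 < x + 1 := by linarith [hx.1]
    have hy1 : 0 < y + 1 := by linarith [hy.1]
    have e : ∀ w : ℝ, critCoeff 0 w = ((5 - 2 * w) / 4) ^ 2 / (2 * (w + 1)) := fun w => by
      simp [critCoeff]
    have e2 : ∀ w : ℝ, 0 < w + 1 → ((5 - 2 * w) / 4) ^ 2 / (2 * (w + 1)) =
        (4 * (w + 1) - 28 + 49 / (w + 1)) / 32 := fun w hw => by field_simp; ring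
    rw [e, e]
    constructor
    · rw [div_le_div_iff₀ (by positivity) (by norm_num)]
      nlinarith [hy.1, hy.2]
    · rw [e2 x hx1, e2 y hy1]
      have h49 : 49 / (x + 1) - 49 / (y + 1) ≤ 196 / 9 * (y - x) := by
        rw [div_sub_div _ _ hx1.ne' hy1.ne', div_le_iff₀ (by positivity)]
        have : 9 / 4 ≤ (x + 1) * (y + 1) := by nlinarith [hx.1, hy.1]
        nlinarith [mul_le_mul_of_nonneg_left this hd]
      linarith
  have h1 := step 0 _ _ (by norm_num) base.1 base.2 (by norm_num)
  have h2 := step 1 _ _ (by norm_num) h1.1 h1.2 (by norm_num)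
  norm_num at h2
  induction j with
  | zero =>
    norm_num
    exact ⟨by linarith [h2.1], by nlinarith [h2.2]⟩
  | succ j ih =>
    have hj : (0 : ℝ) ≤ j := j.cast_nonneg
    obtain ⟨h3, h4⟩ := step (j + 2) _ _ (by positivity) ih.1 ih.2 (by positivity)
    have hp : (0 : ℝ) < (1 / 16) ^ j := by positivity
    have k1 : 1 / (((j + 2 : ℕ) : ℝ) + 5 / 2) ≤ 2 / 9 := by
      rw [div_le_div_iff₀ (by positivity) (by norm_num)]; push_cast; linarith
    have k2 : (9 + 2 * ((j + 2 : ℕ) : ℝ)) / (4 * (((j + 2 : ℕ) : ℝ) + 5 / 2) ^ 2) ≤ 13 / 81 := by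
      rw [div_le_div_iff₀ (by positivity) (by norm_num)]; push_cast; nlinarith
    have k3 : (5 : ℝ) ≤ ((j + 2 : ℕ) : ℝ) + 3 := by push_cast; linarith
    rw [show j + 1 + 2 = j + 2 + 1 by ring, pow_succ]
    constructor
    · refine h3.trans ?_
      calc _ ≤ 1 / 300 * (1 / 16 : ℝ) ^ j * (2 / 9) / 5 := by gcongr
        _ ≤ _ := by linarith
    · refine h4.trans ?_
      gcongr
      calc _ ≤ (11 / 1000 * (1 / 16 : ℝ) ^ j * (2 / 9) +
            1 / 300 * (1 / 16 : ℝ) ^ j * (13 / 81)) / 5 := by gcongr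
        _ ≤ _ := by linarith

/-- The linear factor is at most `8 * 2 ^ j`, which turns the rate `1/16` into `1/8`. Passing from
`y - x` to `y² - x²` uses `x + y ≥ 1` and makes the loss comparable with the summand `ν²`. -/
theorem critTerm_two_add_sub_le {x y : ℝ} (hx : x ∈ Icc (1 / 2 : ℝ) (3 / 2))
    (hy : y ∈ Icc (1 / 2 : ℝ) (3 / 2)) (hxy : x ≤ y) (j : ℕ) :
    critTerm (j + 2) x - critTerm (j + 2) y ≤ 11 / 125 * (1 / 8) ^ j * (y ^ 2 - x ^ 2) := by
  have hd : 0 ≤ y - x := by linarith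
  have hj : (0 : ℝ) ≤ j := j.cast_nonneg
  obtain ⟨-, h⟩ := critCoeff_two_add_bounds hx hy hxy j
  have hcy := critCoeff_pos hy (j + 2)
  have hpow : (8 + 2 * j : ℝ) ≤ 8 * 2 ^ j := by
    have : (1 + j : ℝ) ≤ 2 ^ j := by
      have := one_add_mul_le_pow (by norm_num : (-2 : ℝ) ≤ 1) j
      norm_num at this
      exact this
    linarith
  have hx1 := hx.1
  calc critTerm (j + 2) x - critTerm (j + 2) y
      = (2 * x + 2 * (j + 2) + 1) * (critCoeff (j + 2) x - critCoeff (j + 2) y) -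
        2 * (y - x) * critCoeff (j + 2) y := by
        simp only [critTerm]; push_cast; ring
    _ ≤ (2 * x + 2 * (j + 2) + 1) * (critCoeff (j + 2) x - critCoeff (j + 2) y) := by
        have : 0 ≤ 2 * (y - x) * critCoeff (j + 2) y := by positivity
        linarith
    _ ≤ (2 * x + 2 * (j + 2) + 1) * (11 / 1000 * (1 / 16) ^ j * (y - x)) := by gcongr
    _ ≤ (8 * 2 ^ j) * (11 / 1000 * (1 / 16) ^ j * (y - x)) := by
        gcongr; linarith [hx.2]
    _ = 11 / 125 * (1 / 8) ^ j * (y - x) := by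
        rw [show (1 / 8 : ℝ) = 2 * (1 / 16) by norm_num, mul_pow]; ring
    _ ≤ 11 / 125 * (1 / 8) ^ j * (y ^ 2 - x ^ 2) := by
        have : y - x ≤ y ^ 2 - x ^ 2 := by nlinarith [hy.1]
        exact mul_le_mul_of_nonneg_left this (by positivity)

theorem monotoneOn_critTerm_zero_add :
    MonotoneOn (fun ν => critTerm 0 ν + 47 / 100 * ν ^ 2) (Icc (1 / 2 : ℝ) (3 / 2)) := by
  have e : (fun ν => critTerm 0 ν + 47 / 100 * ν ^ 2) =
      fun ν => (2 * ν + 1) * (5 - 2 * ν) ^ 2 / (32 * (ν + 1)) + 47 / 100 * ν ^ 2 := by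
    funext ν
    simp only [critTerm, critCoeff]
    simp only [div_eq_mul_inv, mul_inv]
    simp
    ring
  rw [e]
  have hd : ∀ ν ∈ Icc (1 / 2 : ℝ) (3 / 2), HasDerivAt
      (fun ν => (2 * ν + 1) * (5 - 2 * ν) ^ 2 / (32 * (ν + 1)) + 47 / 100 * ν ^ 2)
      ((94 / 100 * ν * (32 * (ν + 1) ^ 2) - (5 - 2 * ν) * (8 * ν ^ 2 + 14 * ν - 1)) /
        (32 * (ν + 1) ^ 2)) ν := fun ν hν => by
    have h1 : ν + 1 ≠ 0 := by linarith [hν.1]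
    have i := hasDerivAt_id ν
    refine ((((i.const_mul 2).add_const 1).mul (((i.const_mul 2).const_sub 5).pow 2)).div
      ((i.add_const 1).const_mul 32) (by simpa using h1) |>.add
        ((i.pow 2).const_mul (47 / 100))).congr_deriv ?_
    simp
    field_simp
    ring
  refine monotoneOn_of_deriv_nonneg (convex_Icc _ _)
    (fun ν hν => (hd ν hν).continuousAt.continuousWithinAt)
    (fun ν hν => (hd ν (interior_subset hν)).differentiableAt.differentiableWithinAt)
    fun ν hν => ?_
  have hν' := interior_subset hν
  rw [(hd ν hν').deriv]
  -- Expanded about the left endpoint, the numerator has only nonnegative coefficients.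
  obtain ⟨x, rfl⟩ : ∃ x, ν = x + 1 / 2 := ⟨ν - 1 / 2, by ring⟩
  have hx : 0 ≤ x := by linarith [hν'.1]
  refine div_nonneg ?_ (by positivity)
  ring_nf
  positivity

theorem monotoneOn_critTerm_one_add :
    MonotoneOn (fun ν => critTerm 1 ν + 42 / 100 * ν ^ 2) (Icc (1 / 2 : ℝ) (3 / 2)) := by
  have e : (fun ν => critTerm 1 ν + 42 / 100 * ν ^ 2) =
      fun ν => (2 * ν + 3) * (5 - 2 * ν) ^ 3 / (384 * ((ν + 1) * (ν + 2))) +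
        42 / 100 * ν ^ 2 := by
    funext ν
    simp only [critTerm, critCoeff, Finset.prod_range_succ, Finset.prod_range_zero,
      Nat.factorial]
    push_cast
    rw [show ν + 1 + 1 = ν + 2 by ring]
    simp only [div_eq_mul_inv, mul_inv]
    simp
    ring
  rw [e]
  have hd : ∀ ν ∈ Icc (1 / 2 : ℝ) (3 / 2), HasDerivAt
      (fun ν => (2 * ν + 3) * (5 - 2 * ν) ^ 3 / (384 * ((ν + 1) * (ν + 2))) + 42 / 100 * ν ^ 2)
      ((84 / 100 * ν * (384 * ((ν + 1) * (ν + 2)) ^ 2) - (5 - 2 * ν) ^ 2 *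
        ((8 + 16 * ν) * ((ν + 1) * (ν + 2)) + (5 - 2 * ν) * (2 * ν + 3) ^ 2)) /
        (384 * ((ν + 1) * (ν + 2)) ^ 2)) ν := fun ν hν => by
    have h1 : ν + 1 ≠ 0 := by linarith [hν.1]
    have h2 : ν + 2 ≠ 0 := by linarith [hν.1]
    have i := hasDerivAt_id ν
    refine ((((i.const_mul 2).add_const 3).mul (((i.const_mul 2).const_sub 5).pow 3)).div
      (((i.add_const 1).mul (i.add_const 2)).const_mul 384) (by simpa using ⟨h1, h2⟩) |>.add
        ((i.pow 2).const_mul (42 / 100))).congr_deriv ?_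
    simp
    field_simp
    ring
  refine monotoneOn_of_deriv_nonneg (convex_Icc _ _)
    (fun ν hν => (hd ν hν).continuousAt.continuousWithinAt)
    (fun ν hν => (hd ν (interior_subset hν)).differentiableAt.differentiableWithinAt)
    fun ν hν => ?_
  have hν' := interior_subset hν
  rw [(hd ν hν').deriv]
  obtain ⟨x, rfl⟩ : ∃ x, ν = x + 1 / 2 := ⟨ν - 1 / 2, by ring⟩
  have hx : 0 ≤ x := by linarith [hν'.1]
  refine div_nonneg ?_ (by positivity)
  ring_nf
  positivity

/-- The losses, in units of `y² - x²`, are at most `0.47` and `0.42` for the first two terms and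
`11/125 * 8/7 < 0.101` for the tail. Their sum stays below the gain `1` from `ν²`. -/
theorem strictMonoOn_critFun : StrictMonoOn critFun (Icc (1 / 2 : ℝ) (3 / 2)) := by
  intro x hx y hy hxy
  have hd : 0 < y ^ 2 - x ^ 2 := by nlinarith [hx.1]
  have h0 := monotoneOn_critTerm_zero_add hx hy hxy.le
  have h1 := monotoneOn_critTerm_one_add hx hy hxy.le
  have sx := summable_critTerm hx
  have sy := summable_critTerm hy
  have hg : HasSum (fun j : ℕ => 11 / 125 * (1 / 8 : ℝ) ^ j * (y ^ 2 - x ^ 2))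
      (11 / 125 * (8 / 7) * (y ^ 2 - x ^ 2)) := by
    have := ((hasSum_geometric_of_lt_one (r := (1 / 8 : ℝ)) (by norm_num)
      (by norm_num)).mul_left (11 / 125)).mul_right (y ^ 2 - x ^ 2)
    norm_num at this ⊢
    exact this
  have htail := hasSum_le (critTerm_two_add_sub_le hx hy hxy.le)
    (((summable_nat_add_iff 2).2 sx).hasSum.sub ((summable_nat_add_iff 2).2 sy).hasSum) hg
  have ex := sx.sum_add_tsum_nat_add 2
  have ey := sy.sum_add_tsum_nat_add 2
  simp only [Finset.sum_range_succ, Finset.sum_range_zero, zero_add] at ex ey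
  simp only [critFun]
  rw [← ex, ← ey]
  simp only at h0 h1
  linarith

theorem continuousOn_critFun : ContinuousOn critFun (Icc (1 / 2 : ℝ) (3 / 2)) := by
  have hterm : ∀ j, ContinuousOn (critTerm j) (Icc (1 / 2 : ℝ) (3 / 2)) := fun j =>
    ContinuousOn.mul (by fun_prop) (continuousOn_critCoeff j)
  obtain ⟨M, hM⟩ := isCompact_Icc.exists_bound_of_continuousOn (hterm 2)
  have htail : ContinuousOn (fun ν => ∑' j, critTerm (j + 2) ν) (Icc (1 / 2 : ℝ) (3 / 2)) := by
    refine continuousOn_tsum (u := fun j => M * (1 / 16 : ℝ) ^ j) (fun j => hterm _)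
      ((summable_geometric_of_lt_one (by norm_num) (by norm_num)).mul_left _) fun j ν hν => ?_
    rw [Real.norm_of_nonneg (critTerm_pos hν _).le]
    refine (critTerm_add_le hν 0 j).trans ?_
    have := (le_abs_self _).trans (hM ν hν)
    gcongr
  refine ContinuousOn.congr (f := fun ν => ν ^ 2 - 5 / 4 + (critTerm 0 ν + critTerm 1 ν +
    ∑' j, critTerm (j + 2) ν)) ?_ fun ν hν => ?_
  · exact ContinuousOn.add (by fun_prop) (((hterm 0).add (hterm 1)).add htail)
  · rw [critFun, ← (summable_critTerm hν).sum_add_tsum_nat_add 2]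
    simp [Finset.sum_range_succ]

/-! ### Numerical location of the root and conclusion -/

/-- The two evaluation points are the ends of the rounding interval `0.78449776 ± 5 * 10⁻⁹`. The
upper bound adds a geometric tail to the partial sum; the lower bound at the other end just drops
the positive tail. -/
theorem critFun_neg_at : critFun (784497755 / 10 ^ 9) < 0 := by
  have h := tsum_critTerm_le (ν := 784497755 / 10 ^ 9) ⟨by norm_num, by norm_num⟩ 4
  have h2 : (784497755 / 10 ^ 9 : ℝ) ^ 2 - 5 / 4 +
      (∑ j ∈ Finset.range (4 + 2), critTerm j (784497755 / 10 ^ 9) +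
        critTerm (4 + 2) (784497755 / 10 ^ 9) * (16 / 15)) < 0 := by
    simp only [Finset.sum_range_succ, Finset.sum_range_zero, critTerm, critCoeff,
      Finset.prod_range_succ, Finset.prod_range_zero, Nat.factorial]
    norm_num
  unfold critFun
  linarith

theorem critFun_pos_at : 0 < critFun (784497765 / 10 ^ 9) := by
  have h := sum_le_tsum_critTerm (ν := 784497765 / 10 ^ 9) ⟨by norm_num, by norm_num⟩ 7
  have h2 : 0 < (784497765 / 10 ^ 9 : ℝ) ^ 2 - 5 / 4 +
      ∑ j ∈ Finset.range 7, critTerm j (784497765 / 10 ^ 9) := by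
    simp only [Finset.sum_range_succ, Finset.sum_range_zero, critTerm, critCoeff,
      Finset.prod_range_succ, Finset.prod_range_zero, Nat.factorial]
    norm_num
  unfold critFun
  linarith

theorem corollary1 :
    (∀ ν a : ℝ, 1 / 2 ≤ ν → 0 ≤ a → a ≤ 1 →
      LogConcaveOn (Ici 0) (fun b => 1 - marcumQ ν a b)) ∧
    ∃ ν₀ : ℝ, IsCriticalOrder ν₀ ∧ (∀ μ : ℝ, IsCriticalOrder μ → μ = ν₀) ∧
      |ν₀ - 78449776 / 10 ^ 8| ≤ 1 / (2 * 10 ^ 8) ∧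
      ∀ ν a : ℝ, ν₀ ≤ ν → 0 ≤ a →
        LogConcaveOn (Ici 0) (fun b => 1 - marcumQ ν a b) := by
  refine ⟨fun ν a hν ha ha1 => logConcaveOn_one_sub_marcumQ_of_le_one hν ha ha1, ?_⟩
  obtain ⟨ν₀, hmem, h0⟩ : ∃ ν₀ ∈ Icc (784497755 / 10 ^ 9 : ℝ) (784497765 / 10 ^ 9),
      critFun ν₀ = 0 :=
    intermediate_value_Icc (by norm_num)
      (continuousOn_critFun.mono (Icc_subset_Icc (by norm_num) (by norm_num)))
      ⟨critFun_neg_at.le, critFun_pos_at.le⟩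
  have hIoo : ν₀ ∈ Ioo (1 / 2 : ℝ) (3 / 2) :=
    ⟨lt_of_lt_of_le (by norm_num) hmem.1, lt_of_le_of_lt hmem.2 (by norm_num)⟩
  have hIcc := Ioo_subset_Icc_self hIoo
  refine ⟨ν₀, isCriticalOrder_iff.2 ⟨hIoo, h0⟩, fun μ hμ => ?_, ?_, fun ν a hν ha => ?_⟩
  · obtain ⟨hμ1, hμ2⟩ := isCriticalOrder_iff.1 hμ
    exact strictMonoOn_critFun.injOn (Ioo_subset_Icc_self hμ1) hIcc (hμ2.trans h0.symm)
  · rw [abs_le]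
    have h1 := hmem.1
    have h2 := hmem.2
    norm_num at h1 h2 ⊢
    constructor <;> linarith
  · have hν1 : 1 / 2 ≤ ν := hIcc.1.trans hν
    refine logConcaveOn_one_sub_marcumQ_of_critical hν1 ?_ ha
    refine (le_total (3 / 2) ν).imp_right fun h => ?_
    rw [← critFun_nonneg_iff hν1 h, ← h0]
    exact strictMonoOn_critFun.monotoneOn hIcc ⟨hν1, h⟩ hν
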